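/- Let $k$ be a field and let $B=\bigoplus_{i\ge 0}B_i$ be a connected graded associative unital $k$-algebra, i.e. $B_0=k$; put $B_+=\bigoplus_{i>0}B_i$, so $B=k\oplus B_+$. Let $B\langle z\rangle$ be the free product over $k$ of $B$ with the polynomial algebra $k[z]$, and let $A=B\langle z\rangle/(zB_+)$ be its quotient by the two-sided ideal generated by the elements $zb$, $b\in B_+$. Grade $A$ by the grading of $B$ and $\deg z=1$; then $A$ is a connected graded algebra. For $d\in\mathbb Z$ let $A(d)$ be the graded right $A$-module with $A(d)_e=A_{d+e}$ (where $A_n=0$ for $n<0$), and let $k(d)=(A/A_+)(d)$. A graded right $A$-module is called finitely generated if it is the image of a degree-preserving homomorphism from a finite direct sum of modules $A(d)$. A graded right $A$-module $M$ is called coherent if it is finitely generated and, for every finite direct sum $P$ of modules $A(d)$, the kernel of every degree-preserving homomorphism $P\to M$ is finitely generated. The graded algebra $A$ is called right coherent if all the graded right modules $A(d)$ and $k(d)$, $d\in\mathbb Z$, are coherent. (i) If $B$ is right Noetherian, then $A$ is right coherent. (ii) If $B$ is infinite-dimensional over $k$, then $A$ is not right Noetherian. -/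

import Mathlib

/-! ### Free product of two algebras -/

section FreeProduct

variable (k : Type*) [Field k] (B : Type*) [Ring B] [Algebra k B] (C : Type*) [Ring C] [Algebra k C]

/-- The relations making both `B` and `C` subject to their own algebra structure. -/
inductive FreeProdRel : FreeAlgebra k (B ⊕ C) → FreeAlgebra k (B ⊕ C) → Prop
  | add_left (b b' : B) : FreeProdRel (FreeAlgebra.ι k (Sum.inl (b + b')))
      (FreeAlgebra.ι k (Sum.inl b) + FreeAlgebra.ι k (Sum.inl b'))
  | mul_left (b b' : B) : FreeProdRel (FreeAlgebra.ι k (Sum.inl (b * b')))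
      (FreeAlgebra.ι k (Sum.inl b) * FreeAlgebra.ι k (Sum.inl b'))
  | scalar_left (r : k) : FreeProdRel (FreeAlgebra.ι k (Sum.inl (algebraMap k B r)))
      (algebraMap k (FreeAlgebra k (B ⊕ C)) r)
  | add_right (c c' : C) : FreeProdRel (FreeAlgebra.ι k (Sum.inr (c + c')))
      (FreeAlgebra.ι k (Sum.inr c) + FreeAlgebra.ι k (Sum.inr c'))
  | mul_right (c c' : C) : FreeProdRel (FreeAlgebra.ι k (Sum.inr (c * c')))
      (FreeAlgebra.ι k (Sum.inr c) * FreeAlgebra.ι k (Sum.inr c'))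
  | scalar_right (r : k) : FreeProdRel (FreeAlgebra.ι k (Sum.inr (algebraMap k C r)))
      (algebraMap k (FreeAlgebra k (B ⊕ C)) r)

/-- The free product (coproduct of `k`-algebras) of `B` and `C`. -/
abbrev FreeProd := RingQuot (FreeProdRel k B C)

namespace FreeProd

/-- The canonical homomorphism from the first factor. -/
noncomputable def inl : B →ₐ[k] FreeProd k B C :=
  AlgHom.ofLinearMap
    { toFun := fun b => RingQuot.mkAlgHom k (FreeProdRel k B C) (FreeAlgebra.ι k (Sum.inl b))
      map_add' := fun b b' => by
        rw [RingQuot.mkAlgHom_rel k (FreeProdRel.add_left b b'), map_add]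
      map_smul' := fun r b => by
        rw [Algebra.smul_def, RingQuot.mkAlgHom_rel k (FreeProdRel.mul_left _ b), map_mul,
          RingQuot.mkAlgHom_rel k (FreeProdRel.scalar_left r), AlgHom.commutes, RingHom.id_apply,
          Algebra.smul_def] }
    (by
      have h := RingQuot.mkAlgHom_rel k (FreeProdRel.scalar_left (B := B) (C := C) (1 : k))
      simpa using h)
    (fun b b' => by
      simp only [LinearMap.coe_mk, AddHom.coe_mk]
      rw [RingQuot.mkAlgHom_rel k (FreeProdRel.mul_left b b'), map_mul])

/-- The canonical homomorphism from the second factor. -/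
noncomputable def inr : C →ₐ[k] FreeProd k B C :=
  AlgHom.ofLinearMap
    { toFun := fun b => RingQuot.mkAlgHom k (FreeProdRel k B C) (FreeAlgebra.ι k (Sum.inr b))
      map_add' := fun b b' => by
        rw [RingQuot.mkAlgHom_rel k (FreeProdRel.add_right b b'), map_add]
      map_smul' := fun r b => by
        rw [Algebra.smul_def, RingQuot.mkAlgHom_rel k (FreeProdRel.mul_right _ b), map_mul,
          RingQuot.mkAlgHom_rel k (FreeProdRel.scalar_right r), AlgHom.commutes, RingHom.id_apply,
          Algebra.smul_def] }
    (by
      have h := RingQuot.mkAlgHom_rel k (FreeProdRel.scalar_right (B := B) (C := C) (1 : k))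
      simpa using h)
    (fun b b' => by
      simp only [LinearMap.coe_mk, AddHom.coe_mk]
      rw [RingQuot.mkAlgHom_rel k (FreeProdRel.mul_right b b'), map_mul])

variable {k B C}

/-- The universal property of the free product: existence. -/
noncomputable def lift {D : Type*} [Semiring D] [Algebra k D] (f : B →ₐ[k] D) (g : C →ₐ[k] D) :
    FreeProd k B C →ₐ[k] D :=
  RingQuot.liftAlgHom k ⟨FreeAlgebra.lift k (Sum.elim f g), fun x y h => by
    cases h <;> simp⟩

theorem lift_inl {D : Type*} [Semiring D] [Algebra k D] (f : B →ₐ[k] D) (g : C →ₐ[k] D) (b : B) :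
    lift f g (inl k B C b) = f b := by
  simp [lift, inl]

theorem lift_inr {D : Type*} [Semiring D] [Algebra k D] (f : B →ₐ[k] D) (g : C →ₐ[k] D) (c : C) :
    lift f g (inr k B C c) = g c := by
  simp [lift, inr]

/-- The universal property of the free product: uniqueness. -/
theorem hom_ext {D : Type*} [Semiring D] [Algebra k D] {F G : FreeProd k B C →ₐ[k] D}
    (hl : ∀ b, F (inl k B C b) = G (inl k B C b)) (hr : ∀ c, F (inr k B C c) = G (inr k B C c)) :
    F = G := by
  apply RingQuot.ringQuot_ext'
  apply FreeAlgebra.hom_ext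
  funext x
  cases x with
  | inl b => exact hl b
  | inr c => exact hr c

end FreeProd

end FreeProduct

/-! ### Connected graded algebras -/

section Graded

variable {k : Type*} [Field k] {A : Type*} [Ring A] [Algebra k A]

/-- `A₀ = k`: the structure map identifies `k` with the degree zero part. -/
structure IsConnectedGrading (𝒜 : ℕ → Submodule k A) : Prop where
  injective : Function.Injective (algebraMap k A)
  zero_eq : 𝒜 0 = 1

/-- `A₊ = ⊕_{i > 0} A_i`. -/
def positivePart (𝒜 : ℕ → Submodule k A) : Submodule k A :=
  ⨆ i : ℕ, 𝒜 (i + 1)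

end Graded

/-! ### The algebra `B⟨z⟩ / (z B₊)` -/

section Construction

variable {k : Type*} [Field k] {B : Type*} [Ring B] [Algebra k B] (ℬ : ℕ → Submodule k B)

/-- The relations `z b = 0`, `b ∈ B₊`, in the free product of `B` and `k[z]`. -/
inductive ZExtRel : FreeProd k B (Polynomial k) → FreeProd k B (Polynomial k) → Prop
  | mk (b : B) (hb : b ∈ positivePart ℬ) :
      ZExtRel (FreeProd.inr k B (Polynomial k) Polynomial.X * FreeProd.inl k B (Polynomial k) b) 0

/-- The algebra `B⟨z⟩ / (z B₊)`, the quotient of `B⟨z⟩` by the two-sided ideal generated by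
`z B₊`. -/
def ZExt := RingQuot (ZExtRel ℬ)

namespace ZExt

noncomputable instance : Ring (ZExt ℬ) := inferInstanceAs (Ring (RingQuot (ZExtRel ℬ)))

noncomputable instance : Algebra k (ZExt ℬ) := inferInstanceAs (Algebra k (RingQuot (ZExtRel ℬ)))

/-- The quotient map `B⟨z⟩ → B⟨z⟩ / (z B₊)`. -/
noncomputable def mk : FreeProd k B (Polynomial k) →ₐ[k] ZExt ℬ :=
  RingQuot.mkAlgHom k (ZExtRel ℬ)

/-- The canonical homomorphism `B → B⟨z⟩ / (z B₊)`. -/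
noncomputable def ofB : B →ₐ[k] ZExt ℬ :=
  (mk ℬ).comp (FreeProd.inl k B (Polynomial k))

/-- The class of `z`. -/
noncomputable def z : ZExt ℬ :=
  mk ℬ (FreeProd.inr k B (Polynomial k) Polynomial.X)

theorem z_mul_ofB {b : B} (hb : b ∈ positivePart ℬ) : z ℬ * ofB ℬ b = 0 := by
  have h : mk ℬ _ = mk ℬ _ := RingQuot.mkAlgHom_rel k (ZExtRel.mk b hb)
  simpa [z, ofB] using h

/-- The universal property of `B⟨z⟩ / (z B₊)`: existence. -/
noncomputable def lift {D : Type*} [Semiring D] [Algebra k D] (f : B →ₐ[k] D) (d : D)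
    (h : ∀ b ∈ positivePart ℬ, d * f b = 0) : ZExt ℬ →ₐ[k] D :=
  RingQuot.liftAlgHom k ⟨FreeProd.lift f (Polynomial.aeval d), fun x y hxy => by
    cases hxy with
    | mk b hb => simp [FreeProd.lift_inl, FreeProd.lift_inr, h b hb]⟩

theorem lift_mk {D : Type*} [Semiring D] [Algebra k D] (f : B →ₐ[k] D) (d : D)
    (h : ∀ b ∈ positivePart ℬ, d * f b = 0) (x : FreeProd k B (Polynomial k)) :
    lift ℬ f d h (mk ℬ x) = FreeProd.lift f (Polynomial.aeval d) x :=
  RingQuot.liftAlgHom_mkAlgHom_apply k _ _ x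

theorem lift_ofB {D : Type*} [Semiring D] [Algebra k D] (f : B →ₐ[k] D) (d : D)
    (h : ∀ b ∈ positivePart ℬ, d * f b = 0) (b : B) : lift ℬ f d h (ofB ℬ b) = f b := by
  simp [ofB, lift_mk, FreeProd.lift_inl]

theorem lift_z {D : Type*} [Semiring D] [Algebra k D] (f : B →ₐ[k] D) (d : D)
    (h : ∀ b ∈ positivePart ℬ, d * f b = 0) : lift ℬ f d h (z ℬ) = d := by
  simp [z, lift_mk, FreeProd.lift_inr]

variable {ℬ} in
/-- The universal property of `B⟨z⟩ / (z B₊)`: uniqueness. -/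
theorem hom_ext {D : Type*} [Semiring D] [Algebra k D] {F G : ZExt ℬ →ₐ[k] D}
    (hB : ∀ b, F (ofB ℬ b) = G (ofB ℬ b)) (hz : F (z ℬ) = G (z ℬ)) : F = G := by
  apply RingQuot.ringQuot_ext'
  apply FreeProd.hom_ext
  · exact hB
  · intro c
    have : (F.comp (mk ℬ)).comp (FreeProd.inr k B (Polynomial k)) =
        (G.comp (mk ℬ)).comp (FreeProd.inr k B (Polynomial k)) :=
      Polynomial.algHom_ext hz
    exact DFunLike.congr_fun this c

/-- Products of homogeneous elements of `B` and of copies of `z`, with their total degree, where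
`deg z = 1`. -/
inductive IsMonomial : ℕ → ZExt ℬ → Prop
  | ofB (i : ℕ) (b : B) (hb : b ∈ ℬ i) : IsMonomial i (ofB ℬ b)
  | z : IsMonomial 1 (z ℬ)
  | mul (i j : ℕ) (x y : ZExt ℬ) (hx : IsMonomial i x) (hy : IsMonomial j y) :
      IsMonomial (i + j) (x * y)

/-- The grading of `B⟨z⟩ / (z B₊)` induced by that of `B` and `deg z = 1`. -/
noncomputable def grading (n : ℕ) : Submodule k (ZExt ℬ) :=
  Submodule.span k {x | IsMonomial ℬ n x}

variable {ℬ} in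
theorem ofB_mem {i : ℕ} {b : B} (hb : b ∈ ℬ i) : ofB ℬ b ∈ grading ℬ i :=
  Submodule.subset_span (IsMonomial.ofB i b hb)

theorem z_mem : z ℬ ∈ grading ℬ 1 := Submodule.subset_span IsMonomial.z

/-- If `B` is connected, then so is `B⟨z⟩ / (z B₊)`. -/
theorem isConnectedGrading_grading (hB : IsConnectedGrading ℬ) :
    IsConnectedGrading (grading ℬ) where
  injective := by
    intro r s h
    have h' := congrArg (lift ℬ (AlgHom.id k B) 0 (by simp)) h
    rw [AlgHom.commutes, AlgHom.commutes] at h'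
    exact hB.injective h'
  zero_eq := by
    have key : ∀ (n : ℕ) (x : ZExt ℬ), IsMonomial ℬ n x → n = 0 →
        x ∈ (1 : Submodule k (ZExt ℬ)) := by
      intro n x hx
      induction hx with
      | ofB i b hb =>
        rintro rfl
        rw [hB.zero_eq] at hb
        obtain ⟨r, rfl⟩ := Submodule.mem_one.1 hb
        exact Submodule.mem_one.2 ⟨r, by simp⟩
      | z => intro h; omega
      | mul i j x y _ _ hx hy =>
        intro h
        have := Submodule.mul_mem_mul (hx (by omega)) (hy (by omega))
        rwa [one_mul] at this
    apply le_antisymm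
    · exact Submodule.span_le.2 fun x hx => key 0 x hx rfl
    · intro x hx
      obtain ⟨r, rfl⟩ := Submodule.mem_one.1 hx
      refine Submodule.subset_span ?_
      have h : algebraMap k B r ∈ ℬ 0 := by
        rw [hB.zero_eq]
        exact Submodule.mem_one.2 ⟨r, rfl⟩
      have h' := IsMonomial.ofB (ℬ := ℬ) 0 _ h
      rwa [AlgHom.commutes] at h'

variable [GradedAlgebra ℬ]

instance gradedMonoid : SetLike.GradedMonoid (grading ℬ) where
  one_mem := Submodule.subset_span (by
    have h := IsMonomial.ofB (ℬ := ℬ) 0 1 SetLike.GradedOne.one_mem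
    rwa [map_one] at h)
  mul_mem := fun i j x y hx hy => by
    have h : x * y ∈ grading ℬ i * grading ℬ j := Submodule.mul_mem_mul hx hy
    rw [grading, grading, Submodule.span_mul_span] at h
    refine Submodule.span_mono ?_ h
    rintro _ ⟨a, ha, b, hb, rfl⟩
    exact IsMonomial.mul i j a b ha hb

/-- The map `B → ⨁ A_n` sending a homogeneous `b` to its class placed in its degree. -/
noncomputable def decomposeB : B →ₐ[k] DirectSum ℕ (fun n => grading ℬ n) :=
  (DirectSum.toAlgebra k (fun n => ℬ n)
    (fun i => (DirectSum.lof k ℕ (fun n => grading ℬ n) i).comp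
      (((ofB ℬ).toLinearMap.comp (ℬ i).subtype).codRestrict (grading ℬ i)
        (fun b => ofB_mem b.2)))
    (by
      simp only [LinearMap.comp_apply]
      change DirectSum.of (fun n => grading ℬ n) 0 _ = DirectSum.of (fun n => grading ℬ n) 0 1
      congr 1
      ext
      exact map_one (ofB ℬ))
    (by
      intro i j a b
      simp only [LinearMap.comp_apply]
      change DirectSum.of (fun n => grading ℬ n) _ _ =
        DirectSum.of (fun n => grading ℬ n) _ _ * DirectSum.of (fun n => grading ℬ n) _ _
      rw [DirectSum.of_mul_of]
      congr 1
      ext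
      exact map_mul (ofB ℬ) (a : B) (b : B))).comp (DirectSum.decomposeAlgEquiv ℬ).toAlgHom

theorem decomposeB_of_mem {i : ℕ} {b : B} (hb : b ∈ ℬ i) :
    decomposeB ℬ b = DirectSum.of (fun n => grading ℬ n) i
      ⟨ofB ℬ b, ofB_mem hb⟩ := by
  simp only [decomposeB, AlgHom.comp_apply]
  change DirectSum.toAlgebra k (fun n => ℬ n) _ _ _ (DirectSum.decompose ℬ b) = _
  rw [DirectSum.decompose_of_mem ℬ hb, DirectSum.toAlgebra_apply]
  exact DirectSum.toSemiring_of (A := fun n => ℬ n) _ _ _ i ⟨b, hb⟩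

/-- The map splitting an element of `B⟨z⟩ / (z B₊)` into homogeneous components. -/
noncomputable def decomposeHom : ZExt ℬ →ₐ[k] DirectSum ℕ (fun n => grading ℬ n) :=
  lift ℬ (decomposeB ℬ) (DirectSum.of (fun n => grading ℬ n) 1 ⟨z ℬ, z_mem ℬ⟩) (by
    intro b hb
    induction hb using Submodule.iSup_induction' with
    | mem i b hb =>
      rw [decomposeB_of_mem ℬ hb, DirectSum.of_mul_of]
      have h0 : z ℬ * ofB ℬ b = 0 := z_mul_ofB ℬ (Submodule.mem_iSup_of_mem i hb)
      refine Eq.trans (congrArg _ (Subtype.ext h0)) (map_zero _)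
    | zero => simp
    | add x y _ _ hx hy => rw [map_add, mul_add, hx, hy, add_zero])

/-- `B⟨z⟩ / (z B₊)` is a graded algebra. -/
noncomputable instance gradedAlgebra : GradedAlgebra (grading ℬ) :=
  GradedAlgebra.ofAlgHom (grading ℬ) (decomposeHom ℬ)
    (by
      apply hom_ext
      · intro b
        simp only [AlgHom.comp_apply, decomposeHom, lift_ofB, AlgHom.id_apply]
        induction b using DirectSum.Decomposition.inductionOn ℬ with
        | zero => simp
        | homogeneous b => rw [decomposeB_of_mem ℬ b.2]; simp
        | add x y hx hy => simp only [map_add, hx, hy]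
      · simp [decomposeHom, lift_z])
    (by
      intro i x
      obtain ⟨x, hx⟩ := x
      have key : ∀ (n : ℕ) (y : ZExt ℬ), IsMonomial ℬ n y → ∃ h : y ∈ grading ℬ n,
          decomposeHom ℬ y = DirectSum.of (fun n => grading ℬ n) n ⟨y, h⟩ := by
        intro n y hy
        refine ⟨Submodule.subset_span hy, ?_⟩
        induction hy with
        | ofB i b hb => simp only [decomposeHom, lift_ofB, decomposeB_of_mem ℬ hb]
        | z => simp only [decomposeHom, lift_z]
        | mul i j x y hx hy ihx ihy =>
          rw [map_mul, ihx, ihy, DirectSum.of_mul_of]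
          rfl
      change decomposeHom ℬ x = _
      induction hx using Submodule.span_induction with
      | mem y hy => exact (key i y hy).2
      | zero => rw [map_zero]; exact (map_zero _).symm
      | add x y hx hy ihx ihy =>
        rw [map_add, ihx, ihy, ← map_add]
        rfl
      | smul c x hx ih =>
        rw [map_smul, ih]
        exact ((DirectSum.lof k ℕ (fun n => grading ℬ n) i).map_smul c ⟨x, hx⟩).symm)

end ZExt

end Construction

/-! ### Graded right modules and coherence

Right `A`-modules are modules over `Aᵐᵒᵖ`. -/

section Coherence

variable {k : Type*} [Field k] {A : Type*} [Ring A] [Algebra k A] (𝒜 : ℕ → Submodule k A)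

/-- The grading of the shifted free right module `A(d)`: `A(d)_e = A_{d + e}`, which is zero when
`d + e < 0`. -/
def shiftGrading (d e : ℤ) : Submodule k A :=
  if 0 ≤ d + e then 𝒜 (d + e).toNat else ⊥

/-- The grading of the finite direct sum `A(d₁) ⊕ ⋯ ⊕ A(dₙ)`. -/
def freeGrading {n : ℕ} (d : Fin n → ℤ) (e : ℤ) : Submodule k (Fin n → A) :=
  Submodule.pi Set.univ (fun i => shiftGrading 𝒜 (d i) e)

/-- The augmentation right ideal `A₊`. -/
def augIdeal : Submodule Aᵐᵒᵖ A :=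
  Submodule.span Aᵐᵒᵖ (positivePart 𝒜 : Set A)

/-- The grading of the simple module `(A / A₊)(d)`, that is, of `k` placed in degree `-d`. -/
def simpleGrading (d e : ℤ) : Submodule k (A ⧸ augIdeal 𝒜) :=
  (shiftGrading 𝒜 d e).map ((augIdeal 𝒜).mkQ.restrictScalars k)

variable {M : Type*} [AddCommGroup M] [Module k M] [Module Aᵐᵒᵖ M] (ℳ : ℤ → Submodule k M)

/-- `f : A(d₁) ⊕ ⋯ ⊕ A(dₙ) → M` is a homomorphism of graded modules. -/
def IsGradedHom {n : ℕ} (d : Fin n → ℤ) (f : (Fin n → A) →ₗ[Aᵐᵒᵖ] M) : Prop :=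
  ∀ e : ℤ, ∀ v ∈ freeGrading 𝒜 d e, f v ∈ ℳ e

/-- The graded submodule `N` of `M` is finitely generated: it is the image of a homomorphism of
graded modules `A(d₁) ⊕ ⋯ ⊕ A(dₙ) → M`. -/
def IsGradedFG (N : Submodule Aᵐᵒᵖ M) : Prop :=
  ∃ (n : ℕ) (d : Fin n → ℤ) (f : (Fin n → A) →ₗ[Aᵐᵒᵖ] M),
    IsGradedHom 𝒜 ℳ d f ∧ LinearMap.range f = N

/-- The graded right module `M` is coherent: it is finitely generated, and so is the kernel of every
homomorphism of graded modules `A(d₁) ⊕ ⋯ ⊕ A(dₙ) → M`. -/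
def IsCoherentModule : Prop :=
  IsGradedFG 𝒜 ℳ ⊤ ∧
    ∀ (n : ℕ) (d : Fin n → ℤ) (f : (Fin n → A) →ₗ[Aᵐᵒᵖ] M),
      IsGradedHom 𝒜 ℳ d f → IsGradedFG 𝒜 (freeGrading 𝒜 d) (LinearMap.ker f)

/-- The graded algebra `A` is right coherent: all the graded right modules `A(d)` and all the simple
graded modules `(A / A₊)(d)` are coherent. -/
def IsRightCoherent [GradedAlgebra 𝒜] : Prop :=
  (∀ d : ℤ, IsCoherentModule 𝒜 (shiftGrading 𝒜 d)) ∧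
    ∀ d : ℤ, IsCoherentModule 𝒜 (simpleGrading 𝒜 d)

end Coherence

open Polynomial MulOpposite

/-! ### The augmentation of a connected graded algebra -/

section Augmentation

variable {k : Type*} [Field k] {B : Type*} [Ring B] [Algebra k B] {ℬ : ℕ → Submodule k B}
  [GradedAlgebra ℬ]

/-! Write `A = B⟨z⟩/(zB₊)` and let `ε : B → k` be the augmentation. In `A` one has `z b = ε(b) z`,
so every element has a normal form `∑ bⱼ zʲ`. It is unique because `A` acts on `B[X]`, with `z`
acting as `p ↦ X · ε(p)` (`act`, `toPoly`, `ofPoly_toPoly`).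

Let `I` be the kernel of `A → k[z]`, that is, the elements whose coefficients all lie in `B₊`. Since
`z` kills `B₊`, left multiplication by `a` on `I` is coefficientwise multiplication by the constant
coefficient `a₀` (`toPoly_mul_of_toPolyK_eq_zero`).

(i) Let `K` be the kernel of a map from `Aⁿ` to `A` or to `A/A₊`. If `v = ∑ wⱼ zʲ` lies in `K ∩ Iⁿ`,
each `wⱼ ∈ B₊ⁿ` lies in `K` too. Such `wⱼ` form a right `B`-submodule of `Bⁿ`, finitely generated
because `B` is right Noetherian, and its generators also generate `K ∩ Iⁿ`. The rest of `K` is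
controlled by its image in `k[z]ⁿ`, finitely generated by Hilbert's theorem (`fg_of_coeff_mem`).
Homogeneous generators exist because the kernel of a graded map contains the homogeneous components
of its elements (`isGradedFG_ker`).

(ii) In the right ideal generated by `Bz`, `(b z) a` has `z`-coefficient `ε(a₀) b`, a scalar
multiple of `b`. Hence finitely many generators `b z` suffice only if their `b` span `B` over `k`.
-/

theorem IsConnectedGrading.exists_algebraMap_eq_proj (hB : IsConnectedGrading ℬ) (b : B) :
    ∃ r : k, algebraMap k B r = GradedRing.projZeroRingHom ℬ b := by
  have h : GradedRing.projZeroRingHom ℬ b ∈ ℬ 0 := by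
    rw [GradedRing.projZeroRingHom_apply]
    exact SetLike.coe_mem _
  rw [hB.zero_eq] at h
  exact Submodule.mem_one.1 h

/-- The augmentation `B → B₀ = k` of a connected graded algebra. -/
noncomputable def augmentation (hB : IsConnectedGrading ℬ) : B →ₐ[k] k where
  toFun b := (hB.exists_algebraMap_eq_proj b).choose
  map_one' := hB.injective (by
    rw [(hB.exists_algebraMap_eq_proj 1).choose_spec, map_one, map_one])
  map_mul' x y := hB.injective (by
    rw [map_mul (algebraMap k B), (hB.exists_algebraMap_eq_proj x).choose_spec,
      (hB.exists_algebraMap_eq_proj y).choose_spec, ← map_mul]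
    exact (hB.exists_algebraMap_eq_proj (x * y)).choose_spec)
  map_zero' := hB.injective (by
    rw [(hB.exists_algebraMap_eq_proj 0).choose_spec, map_zero, map_zero])
  map_add' x y := hB.injective (by
    rw [map_add (algebraMap k B), (hB.exists_algebraMap_eq_proj x).choose_spec,
      (hB.exists_algebraMap_eq_proj y).choose_spec, ← map_add]
    exact (hB.exists_algebraMap_eq_proj (x + y)).choose_spec)
  commutes' r := hB.injective (by
    rw [(hB.exists_algebraMap_eq_proj _).choose_spec, GradedRing.projZeroRingHom_apply]
    have h : algebraMap k B r ∈ ℬ 0 := by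
      rw [hB.zero_eq]
      exact Submodule.mem_one.2 ⟨r, rfl⟩
    exact DirectSum.decompose_of_mem_same ℬ h)

theorem algebraMap_augmentation (hB : IsConnectedGrading ℬ) (b : B) :
    algebraMap k B (augmentation hB b) = DirectSum.decompose ℬ b 0 :=
  (hB.exists_algebraMap_eq_proj b).choose_spec

theorem augmentation_eq_zero_iff (hB : IsConnectedGrading ℬ) (b : B) :
    augmentation hB b = 0 ↔ b ∈ positivePart ℬ := by
  rw [← map_eq_zero_iff _ hB.injective, algebraMap_augmentation]
  constructor
  · intro h
    classical
    rw [← DirectSum.sum_support_decompose ℬ b]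
    refine Submodule.sum_mem _ fun i _ => ?_
    cases i with
    | zero => rw [h]; exact Submodule.zero_mem _
    | succ i => exact Submodule.mem_iSup_of_mem i (SetLike.coe_mem _)
  · intro h
    induction h using Submodule.iSup_induction' with
    | mem i b hb => exact DirectSum.decompose_of_mem_ne ℬ hb (by omega)
    | zero => simp
    | add x y _ _ hx hy => simp [DirectSum.decompose_add, hx, hy]

end Augmentation

/-! ### Normal forms in `B⟨z⟩ / (z B₊)` -/

namespace ZExt

variable {k : Type*} [Field k] {B : Type*} [Ring B] [Algebra k B] {ℬ : ℕ → Submodule k B}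

/-- `B⟨z⟩ / (z B₊)` is generated by `B` and `z`. -/
theorem subalgebra_eq_top (S : Subalgebra k (ZExt ℬ)) (hS : ∀ b, ofB ℬ b ∈ S)
    (hz : z ℬ ∈ S) : S = ⊤ := by
  -- The universal property gives a map into `S`; followed by the inclusion it fixes the generators,
  -- so it is the identity.
  have h : S.val.comp (lift ℬ ((ofB ℬ).codRestrict S hS) ⟨z ℬ, hz⟩
      (fun b hb => Subtype.ext (z_mul_ofB ℬ hb))) = AlgHom.id k (ZExt ℬ) := by
    apply hom_ext
    · intro b
      simp [lift_ofB]
    · simp [lift_z]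
  refine eq_top_iff.2 fun x _ => ?_
  rw [← AlgHom.id_apply (R := k) x, ← h]
  exact SetLike.coe_mem _

variable (ℬ) in
/-- The element `∑ bⱼ zʲ` with the given coefficients. -/
noncomputable def ofPoly : B[X] →+ ZExt ℬ :=
  Polynomial.eval₂AddMonoidHom (ofB ℬ).toRingHom (z ℬ)

theorem ofPoly_apply (p : B[X]) : ofPoly ℬ p = p.sum fun j b => ofB ℬ b * z ℬ ^ j := by
  simp [ofPoly, eval₂_eq_sum]

theorem ofPoly_monomial (j : ℕ) (b : B) :
    ofPoly ℬ (monomial j b) = ofB ℬ b * z ℬ ^ j := by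
  simp [ofPoly]

theorem ofPoly_C_mul (b : B) (p : B[X]) : ofPoly ℬ (C b * p) = ofB ℬ b * ofPoly ℬ p := by
  induction p using Polynomial.induction_on' with
  | add p q hp hq => simp only [mul_add, map_add, hp, hq]
  | monomial j c => simp only [C_mul_monomial, ofPoly_monomial, map_mul, mul_assoc]

theorem ofB_mem_positivePart {b : B} (hb : b ∈ positivePart ℬ) :
    ofB ℬ b ∈ positivePart (grading ℬ) := by
  induction hb using Submodule.iSup_induction' with
  | mem i b hb => exact Submodule.mem_iSup_of_mem i (ofB_mem hb)
  | zero => rw [map_zero]; exact Submodule.zero_mem _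
  | add x y _ _ hx hy => rw [map_add]; exact Submodule.add_mem _ hx hy

variable [GradedAlgebra ℬ] (hB : IsConnectedGrading ℬ)

/-- Coefficientwise augmentation of a polynomial over `B`. -/
noncomputable def augPoly : B[X] →ₐ[k] B[X] :=
  Polynomial.mapAlgHom ((Algebra.ofId k B).comp (augmentation hB))

theorem augPoly_C (b : B) : augPoly hB (C b) = C (algebraMap k B (augmentation hB b)) := by
  simp [augPoly, Algebra.ofId_apply]

theorem coeff_augPoly (p : B[X]) (j : ℕ) :
    (augPoly hB p).coeff j = algebraMap k B (augmentation hB (p.coeff j)) := by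
  simp [augPoly, Algebra.ofId_apply]

/-- The left action of `B⟨z⟩ / (z B₊)` on normal forms. -/
noncomputable def act : ZExt ℬ →ₐ[k] Module.End k B[X] :=
  lift ℬ ((Algebra.lmul k B[X]).comp (Polynomial.CAlgHom (R := k) (A := B)))
    -- This operator encodes `z · (b zʲ) = ε(b) zʲ⁺¹`.
    ((LinearMap.mulLeft k X).comp (augPoly hB).toLinearMap)
    (by
      intro b hb
      ext1 p
      have h : augPoly hB (C b * p) = 0 := by
        rw [map_mul, augPoly_C, (augmentation_eq_zero_iff hB b).2 hb, map_zero, C_0, zero_mul]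
      simp [h])

theorem act_ofB (b : B) (p : B[X]) : act hB (ofB ℬ b) p = C b * p := by
  simp [act, lift_ofB]

theorem act_z (p : B[X]) : act hB (z ℬ) p = X * augPoly hB p := by
  simp [act, lift_z]

/-- The difference `b - ε(b)` lies in `B₊`, so `z` kills it from the left. -/
theorem z_mul_ofB_eq (b : B) :
    z ℬ * ofB ℬ b = ofB ℬ (algebraMap k B (augmentation hB b)) * z ℬ := by
  have h : z ℬ * ofB ℬ (b - algebraMap k B (augmentation hB b)) = 0 :=
    z_mul_ofB ℬ ((augmentation_eq_zero_iff hB _).1 (by simp))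
  rw [map_sub, mul_sub, sub_eq_zero] at h
  rw [h, AlgHom.commutes, ← Algebra.commutes]

/-- The `a` satisfying this for all `p` form a subalgebra, so only `B` and `z` need checking. Taking
`p = 1` then recovers each element from its normal form. -/
theorem ofPoly_act (a : ZExt ℬ) (p : B[X]) : ofPoly ℬ (act hB a p) = a * ofPoly ℬ p := by
  let S : Subalgebra k (ZExt ℬ) :=
    { carrier := {a | ∀ p, ofPoly ℬ (act hB a p) = a * ofPoly ℬ p}
      mul_mem' := fun {a b} ha hb p => by
        rw [map_mul, Module.End.mul_apply, ha, hb, mul_assoc]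
      add_mem' := fun {a b} ha hb p => by
        rw [map_add, LinearMap.add_apply, map_add, ha, hb, add_mul]
      algebraMap_mem' := fun r p => by
        rw [← AlgHom.commutes (ofB ℬ), act_ofB, ofPoly_C_mul] }
  have hS : S = ⊤ := by
    refine subalgebra_eq_top S (fun b p => by rw [act_ofB, ofPoly_C_mul]) fun p => ?_
    rw [act_z]
    induction p using Polynomial.induction_on' with
    | add p q hp hq => simp only [map_add, mul_add, hp, hq]
    | monomial j c =>
      have : augPoly hB (monomial j c) =
          monomial j (algebraMap k B (augmentation hB c)) := by
        simp [augPoly, Algebra.ofId_apply]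
      rw [this, X_mul_monomial, ofPoly_monomial, ofPoly_monomial, ← mul_assoc,
        z_mul_ofB_eq hB, pow_succ', mul_assoc]
  have : a ∈ S := hS ▸ Algebra.mem_top
  exact this p

/-- The normal form of an element of `B⟨z⟩ / (z B₊)`. -/
noncomputable def toPoly : ZExt ℬ →ₗ[k] B[X] :=
  (LinearMap.applyₗ (1 : B[X])).comp (act hB).toLinearMap

theorem toPoly_apply (a : ZExt ℬ) : toPoly hB a = act hB a 1 := rfl

theorem toPoly_mul (a b : ZExt ℬ) : toPoly hB (a * b) = act hB a (toPoly hB b) := by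
  rw [toPoly_apply, map_mul]; rfl

theorem ofPoly_toPoly (a : ZExt ℬ) : ofPoly ℬ (toPoly hB a) = a := by
  rw [toPoly_apply, ofPoly_act, ← C_1, ← monomial_zero_left, ofPoly_monomial]
  simp

theorem toPoly_z_pow (j : ℕ) : toPoly hB (z ℬ ^ j) = X ^ j := by
  induction j with
  | zero => simp [toPoly_apply]
  | succ j ih =>
    have : augPoly hB (X ^ j) = X ^ j := by simp [augPoly]
    rw [pow_succ', toPoly_mul, ih, act_z, this, pow_succ']

theorem toPoly_ofB_mul_z_pow (b : B) (j : ℕ) :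
    toPoly hB (ofB ℬ b * z ℬ ^ j) = monomial j b := by
  rw [toPoly_mul, toPoly_z_pow, act_ofB, C_mul_X_pow_eq_monomial]

/-- The quotient map `B⟨z⟩ / (z B₊) → k[z]` killing `B₊`. -/
noncomputable def toPolyK : ZExt ℬ →ₐ[k] k[X] :=
  lift ℬ ((Algebra.ofId k k[X]).comp (augmentation hB)) X (by
    intro b hb
    simp [(augmentation_eq_zero_iff hB b).2 hb])

theorem toPolyK_ofB (b : B) : toPolyK hB (ofB ℬ b) = C (augmentation hB b) := by
  simp [toPolyK, lift_ofB, Algebra.ofId_apply]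

theorem toPolyK_z : toPolyK hB (z ℬ) = X := by
  simp [toPolyK, lift_z]

theorem toPolyK_surjective : Function.Surjective (toPolyK hB) := fun p => by
  refine ⟨aeval (z ℬ) p, ?_⟩
  rw [← Polynomial.aeval_algHom_apply, toPolyK_z, aeval_X_left_apply]

theorem toPolyK_eq_map (a : ZExt ℬ) :
    toPolyK hB a = (toPoly hB a).map (augmentation hB).toRingHom := by
  conv_lhs => rw [← ofPoly_toPoly hB a]
  generalize toPoly hB a = p
  induction p using Polynomial.induction_on' with
  | add p q hp hq => simp only [map_add, Polynomial.map_add, hp, hq]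
  | monomial j c =>
    rw [ofPoly_monomial, map_mul, map_pow, toPolyK_z, toPolyK_ofB, C_mul_X_pow_eq_monomial,
      map_monomial]
    rfl

theorem augmentation_coeff_eq_zero {a : ZExt ℬ} (ha : toPolyK hB a = 0) (j : ℕ) :
    augmentation hB ((toPoly hB a).coeff j) = 0 := by
  have h := congrArg (fun p => p.coeff j) ((toPolyK_eq_map hB a).symm.trans ha)
  simpa using h

/-- On the kernel of `B⟨z⟩ / (z B₊) → k[z]`, left multiplication only depends on the constant
coefficient. -/
theorem toPoly_mul_of_toPolyK_eq_zero (a : ZExt ℬ) {x : ZExt ℬ} (hx : toPolyK hB x = 0) :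
    toPoly hB (a * x) = C ((toPoly hB a).coeff 0) * toPoly hB x := by
  have h0 : augPoly hB (toPoly hB x) = 0 := by
    ext j
    rw [coeff_augPoly, augmentation_coeff_eq_zero hB hx, map_zero, coeff_zero]
  rw [toPoly_mul]
  have key : ∀ p : B[X], act hB (ofPoly ℬ p) (toPoly hB x) = C (p.coeff 0) * toPoly hB x := by
    intro p
    induction p using Polynomial.induction_on' with
    | add p q hp hq => simp only [map_add, LinearMap.add_apply, hp, hq, coeff_add, add_mul]
    | monomial j c =>
      rw [ofPoly_monomial, map_mul, Module.End.mul_apply, act_ofB]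
      cases j with
      | zero => simp
      | succ j =>
        rw [pow_succ, map_mul, Module.End.mul_apply, act_z, h0]
        simp [coeff_monomial]
  conv_lhs => rw [← ofPoly_toPoly hB a]
  exact key _

theorem toPoly_ofB (b : B) : toPoly hB (ofB ℬ b) = C b := by
  rw [toPoly_apply, act_ofB, mul_one]

/-- The augmentation ideal of `B⟨z⟩ / (z B₊)` absorbs left multiples of `B₊`. -/
theorem mul_ofB_mem_augIdeal (a : ZExt ℬ) {b : B} (hb : augmentation hB b = 0) :
    a * ofB ℬ b ∈ augIdeal (grading ℬ) := by
  -- Only the constant coefficient of `a` survives, so the product is a single element of `B₊`.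
  have h : toPoly hB (a * ofB ℬ b) = toPoly hB (ofB ℬ ((toPoly hB a).coeff 0 * b)) := by
    rw [toPoly_mul_of_toPolyK_eq_zero hB a (by rw [toPolyK_ofB, hb, C_0]), toPoly_ofB, toPoly_ofB,
      C_mul]
  have h' := congrArg (ofPoly ℬ) h
  rw [ofPoly_toPoly, ofPoly_toPoly] at h'
  rw [h']
  exact Submodule.subset_span (ofB_mem_positivePart
    ((augmentation_eq_zero_iff hB _).1 (by rw [map_mul, hb, mul_zero])))

end ZExt

/-! ### Finite generation of right submodules of free modules -/

/-- A right Noetherian ring is a Noetherian right module over itself. -/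
theorem isNoetherian_op_self {R : Type*} [Ring R] [IsNoetherianRing Rᵐᵒᵖ] :
    IsNoetherian Rᵐᵒᵖ R :=
  isNoetherian_of_linearEquiv (M := Rᵐᵒᵖ) (σ := RingHom.id _) (σ' := RingHom.id _)
    { toFun := unop
      invFun := op
      map_add' := fun _ _ => rfl
      map_smul' := fun _ _ => rfl
      left_inv := fun _ => rfl
      right_inv := fun _ => rfl }

/-- Let `π : A → C` be a surjection onto a commutative Noetherian ring. A right submodule `K` of
`Aⁿ` is finitely generated as soon as a finitely generated submodule of `K` contains all the
vectors of `K` killed by `π`. -/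
theorem Submodule.fg_of_surjective_of_forall_mem {A C : Type*} [Ring A] [CommRing C]
    [IsNoetherianRing C] (π : A →+* C) (hπ : Function.Surjective π) {n : ℕ}
    (K N : Submodule Aᵐᵒᵖ (Fin n → A)) (hN : N.FG) (hNK : N ≤ K)
    (h : ∀ v ∈ K, (∀ i, π (v i) = 0) → v ∈ N) : K.FG := by
  classical
  -- The image of `K` in `Cⁿ`. Commutativity of `C` turns the right action into a left one, and
  -- surjectivity of `π` lifts scalars.
  let L : Submodule C (Fin n → C) :=
    { carrier := {y | ∃ v ∈ K, (fun i => π (v i)) = y}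
      add_mem' := by
        rintro _ _ ⟨v, hv, rfl⟩ ⟨w, hw, rfl⟩
        exact ⟨v + w, K.add_mem hv hw, by ext i; simp⟩
      zero_mem' := ⟨0, K.zero_mem, by ext i; simp⟩
      smul_mem' := by
        rintro c _ ⟨v, hv, rfl⟩
        obtain ⟨a, rfl⟩ := hπ c
        exact ⟨op a • v, K.smul_mem _ hv, by ext i; simp [mul_comm]⟩ }
  obtain ⟨S, hS⟩ := IsNoetherian.noetherian L
  have hlift : ∀ y : S, ∃ v ∈ K, (fun i => π (v i)) = y := fun y =>
    show (y : Fin n → C) ∈ L from hS ▸ Submodule.subset_span y.2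
  choose g hgK hg using hlift
  have hspan : ∀ y ∈ Submodule.span C (S : Set (Fin n → C)),
      ∃ u ∈ Submodule.span Aᵐᵒᵖ (Set.range g), (fun i => π (u i)) = y := by
    intro y hy
    induction hy using Submodule.span_induction with
    | mem y hy => exact ⟨g ⟨y, hy⟩, Submodule.subset_span ⟨_, rfl⟩, hg ⟨y, hy⟩⟩
    | zero => exact ⟨0, Submodule.zero_mem _, by ext i; simp⟩
    | add x y _ _ hx hy =>
      obtain ⟨v, hv, rfl⟩ := hx
      obtain ⟨w, hw, rfl⟩ := hy
      exact ⟨v + w, Submodule.add_mem _ hv hw, by ext i; simp⟩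
    | smul c x _ hx =>
      obtain ⟨v, hv, rfl⟩ := hx
      obtain ⟨a, rfl⟩ := hπ c
      exact ⟨op a • v, Submodule.smul_mem _ _ hv, by ext i; simp [mul_comm]⟩
  have hgK' : Submodule.span Aᵐᵒᵖ (Set.range g) ≤ K :=
    Submodule.span_le.2 (by rintro _ ⟨y, rfl⟩; exact hgK y)
  have hK : K = Submodule.span Aᵐᵒᵖ (Set.range g) ⊔ N := by
    refine le_antisymm (fun v hv => ?_) (sup_le hgK' hNK)
    obtain ⟨u, hu, huv⟩ := hspan (fun i => π (v i)) (hS ▸ (⟨v, hv, rfl⟩ : _ ∈ L))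
    have hvu : v - u ∈ N := h _ (K.sub_mem hv (hgK' hu)) fun i => by
      rw [Pi.sub_apply, map_sub, sub_eq_zero]
      exact (congrFun huv i).symm
    rw [← add_sub_cancel u v]
    exact Submodule.add_mem_sup hu hvu
  rw [hK]
  exact (Submodule.fg_span (Set.finite_range g)).sup hN

/-! ### Kernels and right ideals over `B⟨z⟩ / (z B₊)` -/

namespace ZExt

variable {k : Type*} [Field k] {B : Type*} [Ring B] [Algebra k B] {ℬ : ℕ → Submodule k B}

/-- The vectors over `B₊` whose image lies in a given right submodule. -/
def comapOfB [GradedAlgebra ℬ] (hB : IsConnectedGrading ℬ) {n : ℕ}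
    (K : Submodule (ZExt ℬ)ᵐᵒᵖ (Fin n → ZExt ℬ)) : Submodule Bᵐᵒᵖ (Fin n → B) where
  carrier := {w | (∀ i, augmentation hB (w i) = 0) ∧ (fun i => ofB ℬ (w i)) ∈ K}
  add_mem' := by
    rintro v w ⟨hv, hv'⟩ ⟨hw, hw'⟩
    refine ⟨fun i => by simp [hv, hw], ?_⟩
    convert K.add_mem hv' hw' using 1
    ext i
    simp
  zero_mem' := ⟨fun i => by simp, by
    convert K.zero_mem using 1
    ext i
    simp⟩
  smul_mem' := by
    rintro b w ⟨hw, hw'⟩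
    refine ⟨fun i => by simp [hw, MulOpposite.smul_eq_mul_unop], ?_⟩
    convert K.smul_mem (op (ofB ℬ b.unop)) hw' using 1
    ext i
    simp [MulOpposite.smul_eq_mul_unop]

variable [GradedAlgebra ℬ]

/-- Under `h`, a vector of `K` killed in `k[z]` is a combination, with coefficients `zʲ` on the
right, of vectors from `comapOfB hB K`; finitely many of these suffice over `B`. -/
theorem fg_of_coeff_mem (hB : IsConnectedGrading ℬ)
    [IsNoetherianRing Bᵐᵒᵖ] {n : ℕ}
    (K : Submodule (ZExt ℬ)ᵐᵒᵖ (Fin n → ZExt ℬ))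
    (h : ∀ v ∈ K, (∀ i, toPolyK hB (v i) = 0) →
      ∀ j, (fun i => ofB ℬ ((toPoly hB (v i)).coeff j)) ∈ K) : K.FG := by
  classical
  have : IsNoetherian Bᵐᵒᵖ B := isNoetherian_op_self
  obtain ⟨S, hS⟩ := IsNoetherian.noetherian (comapOfB hB K)
  let ι : (Fin n → B) → Fin n → ZExt ℬ := fun w i => ofB ℬ (w i)
  have hspan : ∀ w ∈ comapOfB hB K, ι w ∈ Submodule.span (ZExt ℬ)ᵐᵒᵖ (ι '' S) := by
    intro w hw
    rw [← hS] at hw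
    induction hw using Submodule.span_induction with
    | mem y hy => exact Submodule.subset_span ⟨y, hy, rfl⟩
    | zero =>
      convert Submodule.zero_mem _ using 1
      ext i
      simp [ι]
    | add x y _ _ hx hy =>
      convert Submodule.add_mem _ hx hy using 1
      ext i
      simp [ι]
    | smul c x _ hx =>
      convert Submodule.smul_mem _ (op (ofB ℬ c.unop)) hx using 1
      ext i
      simp [ι, MulOpposite.smul_eq_mul_unop]
  refine Submodule.fg_of_surjective_of_forall_mem (toPolyK hB).toRingHom (toPolyK_surjective hB) K
    (Submodule.span _ (ι '' S)) (Submodule.fg_span (S.finite_toSet.image ι)) ?_ ?_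
  · rw [Submodule.span_le]
    rintro _ ⟨w, hw, rfl⟩
    have : w ∈ comapOfB hB K := hS ▸ Submodule.subset_span hw
    exact this.2
  · intro v hv hv0
    let J : Finset ℕ := Finset.univ.biUnion fun i => (toPoly hB (v i)).support
    have hsum : v = ∑ j ∈ J, op (z ℬ ^ j) • ι fun i => (toPoly hB (v i)).coeff j := by
      ext i
      rw [Finset.sum_apply]
      conv_lhs => rw [← ofPoly_toPoly hB (v i), ofPoly_apply]
      refine Finset.sum_subset
        (Finset.subset_biUnion_of_mem (fun i => (toPoly hB (v i)).support) (Finset.mem_univ i)) ?_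
      intro j _ hj
      simp [notMem_support_iff.1 hj]
    rw [hsum]
    refine Submodule.sum_mem _ fun j _ => Submodule.smul_mem _ _ (hspan _ ⟨fun i => ?_, ?_⟩)
    · exact augmentation_coeff_eq_zero hB (hv0 i) j
    · exact h v hv hv0 j

theorem linearMap_apply_eq_sum {A M : Type*} [Ring A] [AddCommGroup M] [Module Aᵐᵒᵖ M] {n : ℕ}
    (f : (Fin n → A) →ₗ[Aᵐᵒᵖ] M) (v : Fin n → A) :
    f v = ∑ i, op (v i) • f (Pi.single i 1) := by
  conv_lhs => rw [← Finset.univ_sum_single v]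
  rw [map_sum]
  refine Finset.sum_congr rfl fun i _ => ?_
  rw [← map_smul, ← Pi.single_smul, op_smul_eq_mul, one_mul]

/-- Here `f` is left multiplication by the row of the `f (Pi.single i 1)`. On vectors killed in
`k[z]` it acts coefficientwise, so `f v = 0` forces `f` to vanish on each coefficient vector. -/
theorem fg_ker_self (hB : IsConnectedGrading ℬ)
    [IsNoetherianRing Bᵐᵒᵖ] {n : ℕ}
    (f : (Fin n → ZExt ℬ) →ₗ[(ZExt ℬ)ᵐᵒᵖ] ZExt ℬ) : (LinearMap.ker f).FG := by
  refine fg_of_coeff_mem hB _ fun v hv hv0 j => ?_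
  rw [LinearMap.mem_ker, linearMap_apply_eq_sum] at hv ⊢
  simp only [op_smul_eq_mul] at hv ⊢
  have hv' := congrArg (fun x => (toPoly hB x).coeff j) hv
  have h0 : ∀ i, toPolyK hB (ofB ℬ ((toPoly hB (v i)).coeff j)) = 0 := fun i => by
    rw [toPolyK_ofB, augmentation_coeff_eq_zero hB (hv0 i), C_0]
  simp only [map_sum, toPoly_mul_of_toPolyK_eq_zero hB _ (hv0 _), finsetSum_coeff, coeff_C_mul,
    map_zero, coeff_zero] at hv'
  rw [← ofPoly_toPoly hB (∑ i, _)]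
  simp only [map_sum, toPoly_mul_of_toPolyK_eq_zero hB _ (h0 _), toPoly_ofB, ← C_mul]
  rw [← map_sum, ← map_sum, hv', C_0, map_zero]

/-- Any vector over `B₊` is in the kernel, since left multiples of `B₊` stay in the augmentation
ideal. -/
theorem fg_ker_quotient_augIdeal (hB : IsConnectedGrading ℬ)
    [IsNoetherianRing Bᵐᵒᵖ] {n : ℕ}
    (f : (Fin n → ZExt ℬ) →ₗ[(ZExt ℬ)ᵐᵒᵖ] (ZExt ℬ ⧸ augIdeal (grading ℬ))) :
    (LinearMap.ker f).FG := by
  refine fg_of_coeff_mem hB _ fun v _ hv0 j => ?_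
  rw [LinearMap.mem_ker, linearMap_apply_eq_sum]
  refine Finset.sum_eq_zero fun i _ => ?_
  obtain ⟨a, ha⟩ := Submodule.mkQ_surjective _ (f (Pi.single i 1))
  rw [← ha, ← map_smul, op_smul_eq_mul, Submodule.mkQ_apply, Submodule.Quotient.mk_eq_zero]
  exact mul_ofB_mem_augIdeal hB a (augmentation_coeff_eq_zero hB (hv0 i) j)

theorem finiteDimensional_of_isNoetherianRing (hB : IsConnectedGrading ℬ)
    [IsNoetherianRing (ZExt ℬ)ᵐᵒᵖ] :
    FiniteDimensional k B := by
  have : IsNoetherian (ZExt ℬ)ᵐᵒᵖ (ZExt ℬ) := isNoetherian_op_self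
  -- The finite generating set is extracted from the elements `b z` themselves, so its members keep
  -- this form.
  obtain ⟨S, hS, hspan⟩ := (Submodule.fg_span_iff_fg_span_finset_subset
    (R := (ZExt ℬ)ᵐᵒᵖ) (Set.range fun b => ofB ℬ b * z ℬ)).1 (IsNoetherian.noetherian _)
  let W : Submodule k B := Submodule.span k ((fun s => (toPoly hB s).coeff 1) '' S)
  -- Quantifying over right multiples `x * a` lets the induction pass through scalar multiplication.
  have key : ∀ x ∈ Submodule.span (ZExt ℬ)ᵐᵒᵖ (S : Set (ZExt ℬ)), ∀ a,
      (toPoly hB (x * a)).coeff 1 ∈ W := by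
    intro x hx
    induction hx using Submodule.span_induction with
    | mem x hx =>
      intro a
      obtain ⟨b, rfl⟩ := hS hx
      have hb : b ∈ W := Submodule.subset_span ⟨_, hx, by
        simpa using congrArg (fun p => p.coeff 1) (toPoly_ofB_mul_z_pow hB b 1)⟩
      rw [mul_assoc, toPoly_mul, toPoly_mul, act_ofB, act_z, coeff_C_mul, coeff_X_mul,
        coeff_augPoly, ← Algebra.commutes, ← Algebra.smul_def]
      exact W.smul_mem _ hb
    | zero => intro a; simp
    | add x y _ _ hx hy =>
      intro a
      rw [add_mul, map_add, coeff_add]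
      exact W.add_mem (hx a) (hy a)
    | smul c x _ hx =>
      intro a
      rw [MulOpposite.smul_eq_mul_unop, mul_assoc]
      exact hx _
  have hW : W = ⊤ := eq_top_iff.2 fun b _ => by
    have h := key (ofB ℬ b * z ℬ) (hspan ▸ Submodule.subset_span ⟨b, rfl⟩) 1
    have h1 := congrArg (fun p => p.coeff 1) (toPoly_ofB_mul_z_pow hB b 1)
    simp only [pow_one, coeff_monomial_same] at h1
    rwa [mul_one, h1] at h
  exact ⟨hW ▸ Submodule.fg_span (S.finite_toSet.image _)⟩

end ZExt

/-! ### Homogeneous generators -/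

section Homogeneous

variable {k : Type*} [Field k] {A : Type*} [Ring A] [Algebra k A] {𝒜 : ℕ → Submodule k A}

theorem mem_freeGrading {n : ℕ} {d : Fin n → ℤ} {e : ℤ} {v : Fin n → A} :
    v ∈ freeGrading 𝒜 d e ↔ ∀ i, v i ∈ shiftGrading 𝒜 (d i) e := by
  simp [freeGrading]

/-- This makes left multiplication by an element of `A(d)_e` a graded map `A(-e) → A(d)`. -/
theorem mul_mem_shiftGrading [SetLike.GradedMonoid 𝒜] {d e e' : ℤ} {x y : A}
    (hx : x ∈ shiftGrading 𝒜 d e) (hy : y ∈ shiftGrading 𝒜 (-e) e') :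
    x * y ∈ shiftGrading 𝒜 d e' := by
  unfold shiftGrading at *
  split_ifs at hx with h1
  · split_ifs at hy with h2
    · rw [if_pos (by omega)]
      have h := SetLike.mul_mem_graded hx hy
      rwa [show (d + e).toNat + (-e + e').toNat = (d + e').toNat by omega] at h
    · rw [(Submodule.mem_bot k).1 hy, mul_zero]
      exact Submodule.zero_mem _
  · rw [(Submodule.mem_bot k).1 hx, zero_mul]
    exact Submodule.zero_mem _

section Component

variable [GradedAlgebra 𝒜]

variable (𝒜) in
/-- The component of degree `e` of an element of `A(d)`. -/
noncomputable def shiftComponent (d e : ℤ) : A →+ A :=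
  if 0 ≤ d + e then (GradedAlgebra.proj 𝒜 (d + e).toNat).toAddMonoidHom else 0

theorem shiftComponent_mem (d e : ℤ) (a : A) :
    shiftComponent 𝒜 d e a ∈ shiftGrading 𝒜 d e := by
  unfold shiftComponent shiftGrading
  split_ifs
  · simp [GradedAlgebra.proj_apply]
  · simp

theorem shiftComponent_of_mem_same {d e : ℤ} {a : A} (ha : a ∈ shiftGrading 𝒜 d e) :
    shiftComponent 𝒜 d e a = a := by
  unfold shiftComponent shiftGrading at *
  split_ifs at *
  · exact DirectSum.decompose_of_mem_same 𝒜 ha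
  · exact ((Submodule.mem_bot k).1 ha).symm

theorem shiftComponent_of_mem_ne {d e e' : ℤ} (h : e' ≠ e) {a : A}
    (ha : a ∈ shiftGrading 𝒜 d e') : shiftComponent 𝒜 d e a = 0 := by
  unfold shiftComponent shiftGrading at *
  split_ifs at *
  · exact DirectSum.decompose_of_mem_ne 𝒜 ha (by omega)
  · rw [(Submodule.mem_bot k).1 ha, map_zero]
  · rfl
  · rfl

theorem exists_sum_shiftComponent_eq {n : ℕ} (d : Fin n → ℤ) (v : Fin n → A) :
    ∃ E : Finset ℤ, ∑ e ∈ E, (fun i => shiftComponent 𝒜 (d i) e (v i)) = v := by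
  classical
  let s : Fin n → Finset ℤ := fun i =>
    (DirectSum.decompose 𝒜 (v i)).support.image fun m : ℕ => (m : ℤ) - d i
  refine ⟨Finset.univ.biUnion s, ?_⟩
  ext i
  rw [Finset.sum_apply,
    ← Finset.sum_subset (Finset.subset_biUnion_of_mem s (Finset.mem_univ i)),
    Finset.sum_image (fun a _ b _ hab => by simpa using hab)]
  · conv_rhs => rw [← DirectSum.sum_support_decompose 𝒜 (v i)]
    refine Finset.sum_congr rfl fun m _ => ?_
    simp [shiftComponent, GradedAlgebra.proj_apply]
  · intro e _ he
    unfold shiftComponent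
    split_ifs with h
    · by_contra h0
      refine he (Finset.mem_image.2 ⟨(d i + e).toNat, ?_, by omega⟩)
      rw [DFinsupp.mem_support_iff]
      intro h1
      exact h0 (by
        change ((DirectSum.decompose 𝒜 (v i) (d i + e).toNat : 𝒜 _) : A) = 0
        rw [h1]; rfl)
    · rfl

/-- A finitely generated kernel of a homomorphism of graded modules is finitely generated as a
graded module. -/
theorem isGradedFG_ker {M : Type*} [AddCommGroup M] [Module k M] [Module Aᵐᵒᵖ M]
    {ℳ : ℤ → Submodule k M} (p : ℤ → M →+ M) (hp : ∀ e, ∀ x ∈ ℳ e, p e x = x)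
    (hp' : ∀ e e', e' ≠ e → ∀ x ∈ ℳ e', p e x = 0) {n : ℕ} (d : Fin n → ℤ)
    (f : (Fin n → A) →ₗ[Aᵐᵒᵖ] M) (hf : IsGradedHom 𝒜 ℳ d f) (hfg : (LinearMap.ker f).FG) :
    IsGradedFG 𝒜 (freeGrading 𝒜 d) (LinearMap.ker f) := by
  classical
  let T : Set (Fin n → A) := {v | v ∈ LinearMap.ker f ∧ ∃ e, v ∈ freeGrading 𝒜 d e}
  have hT : Submodule.span Aᵐᵒᵖ T = LinearMap.ker f := by
    refine le_antisymm (Submodule.span_le.2 fun v hv => hv.1) fun v hv => ?_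
    obtain ⟨E, hE⟩ := exists_sum_shiftComponent_eq (𝒜 := 𝒜) d v
    let c : ℤ → Fin n → A := fun e i => shiftComponent 𝒜 (d i) e (v i)
    have hc : ∀ e, c e ∈ freeGrading 𝒜 d e := fun e =>
      mem_freeGrading.2 fun i => shiftComponent_mem _ _ _
    rw [← hE]
    refine Submodule.sum_mem _ fun e he => Submodule.subset_span ⟨?_, e, hc e⟩
    rw [LinearMap.mem_ker] at hv ⊢
    -- Projecting `f v = ∑ f (c e')` to degree `e` leaves one term, so each component of `v` is in
    -- the kernel.
    have h : p e (f v) = f (c e) := by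
      conv_lhs => rw [← hE]
      rw [map_sum, map_sum, Finset.sum_eq_single_of_mem e he]
      · exact hp e _ (hf e _ (hc e))
      · exact fun e' _ hne => hp' e e' hne _ (hf e' _ (hc e'))
    change f (c e) = 0
    rw [← h, hv, map_zero]
  rw [← hT, Submodule.fg_span_iff_fg_span_finset_subset] at hfg
  obtain ⟨S, hST, hS⟩ := hfg
  let g : Fin S.card → Fin n → A := fun j => S.equivFin.symm j
  have hg : ∀ j, g j ∈ T := fun j => hST (S.equivFin.symm j).2
  choose e he using fun j => (hg j).2
  let F : (Fin S.card → A) →ₗ[Aᵐᵒᵖ] (Fin n → A) :=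
    { toFun := fun a => ∑ j, op (a j) • g j
      map_add' := fun a b => by simp [add_smul, Finset.sum_add_distrib]
      map_smul' := fun c a => by
        rw [RingHom.id_apply, Finset.smul_sum]
        refine Finset.sum_congr rfl fun j _ => ?_
        rw [smul_smul]
        rfl }
  -- The shift `-e j` puts `1` in degree `e j`, the degree of its image `g j`.
  refine ⟨S.card, fun j => -e j, F, fun e' a ha => ?_, ?_⟩
  · change ∑ j, op (a j) • g j ∈ freeGrading 𝒜 d e'
    refine Submodule.sum_mem (freeGrading 𝒜 d e') fun j _ =>
      mem_freeGrading.2 fun i => ?_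
    exact mul_mem_shiftGrading (mem_freeGrading.1 (he j) i) (mem_freeGrading.1 ha j)
  · rw [← hT, hS]
    refine le_antisymm ?_ (Submodule.span_le.2 fun v hv => ?_)
    · rintro _ ⟨a, rfl⟩
      change ∑ j, op (a j) • g j ∈ Submodule.span Aᵐᵒᵖ (S : Set (Fin n → A))
      exact Submodule.sum_mem _ fun j _ =>
        Submodule.smul_mem _ _ (Submodule.subset_span (S.equivFin.symm j).2)
    · refine ⟨Pi.single (S.equivFin ⟨v, hv⟩) 1, ?_⟩
      change ∑ j, op (Pi.single (M := fun _ => A) (S.equivFin ⟨v, hv⟩) 1 j) • g j = v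
      rw [Finset.sum_eq_single_of_mem (S.equivFin ⟨v, hv⟩) (Finset.mem_univ _)]
      · simp [g]
      · intro j _ hj
        rw [Pi.single_eq_of_ne hj, op_zero, zero_smul]

end Component

/-- A graded module generated by the image of `1 ∈ A(d)` is finitely generated. -/
theorem isGradedFG_top_of_surjective {M : Type*} [AddCommGroup M] [Module k M] [Module Aᵐᵒᵖ M]
    {ℳ : ℤ → Submodule k M} (d : ℤ) (q : A →ₗ[Aᵐᵒᵖ] M) (hq : Function.Surjective q)
    (hqd : ∀ e, ∀ a ∈ shiftGrading 𝒜 d e, q a ∈ ℳ e) : IsGradedFG 𝒜 ℳ ⊤ := by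
  refine ⟨1, fun _ => d, q.comp (LinearMap.proj 0), fun e v hv => ?_, ?_⟩
  · exact hqd e _ (mem_freeGrading.1 hv 0)
  · exact LinearMap.range_eq_top.2 (hq.comp fun a => ⟨fun _ => a, rfl⟩)

theorem eq_zero_of_mem_simpleGrading {d e : ℤ} (h : e ≠ -d) {x : A ⧸ augIdeal 𝒜}
    (hx : x ∈ simpleGrading 𝒜 d e) : x = 0 := by
  obtain ⟨a, ha, rfl⟩ := hx
  refine (Submodule.Quotient.mk_eq_zero _).2 ?_
  unfold shiftGrading at ha
  split_ifs at ha with h1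
  · obtain ⟨m, hm⟩ := Nat.exists_eq_succ_of_ne_zero (show (d + e).toNat ≠ 0 by omega)
    rw [hm] at ha
    exact Submodule.subset_span (Submodule.mem_iSup_of_mem m ha)
  · rw [(Submodule.mem_bot k).1 ha]
    exact Submodule.zero_mem _

end Homogeneous

/-! ### Coherence and failure of the Noetherian property -/

theorem ZExt.isRightCoherent {k : Type*} [Field k] {B : Type*} [Ring B] [Algebra k B]
    {ℬ : ℕ → Submodule k B} [GradedAlgebra ℬ] (hB : IsConnectedGrading ℬ)
    [IsNoetherianRing Bᵐᵒᵖ] : IsRightCoherent (ZExt.grading ℬ) := by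
  refine ⟨fun d => ⟨?_, fun n d' f hf => ?_⟩, fun d => ⟨?_, fun n d' f hf => ?_⟩⟩
  · exact isGradedFG_top_of_surjective d LinearMap.id Function.surjective_id fun _ _ ha => ha
  · exact isGradedFG_ker (shiftComponent (grading ℬ) d) (fun _ _ => shiftComponent_of_mem_same)
      (fun _ _ h _ => shiftComponent_of_mem_ne h) d' f hf (fg_ker_self hB f)
  · exact isGradedFG_top_of_surjective d (augIdeal (grading ℬ)).mkQ (Submodule.mkQ_surjective _)
      fun _ a ha => ⟨a, ha, rfl⟩
  -- The simple module is concentrated in degree `-d`, so its projections are the identity there and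
  -- zero elsewhere.
  · refine isGradedFG_ker (fun e => if e = -d then AddMonoidHom.id _ else 0) (fun e x hx => ?_)
      (fun e e' h x hx => ?_) d' f hf (fg_ker_quotient_augIdeal hB f)
    · split_ifs with h
      · rfl
      · exact (eq_zero_of_mem_simpleGrading h hx).symm
    · split_ifs with h'
      · exact eq_zero_of_mem_simpleGrading (by rwa [← h']) hx
      · rfl

theorem mainTheorem9 {k : Type*} [Field k] {B : Type*} [Ring B] [Algebra k B]
    (ℬ : ℕ → Submodule k B) [GradedAlgebra ℬ] (hB : IsConnectedGrading ℬ) :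
    (IsNoetherianRing Bᵐᵒᵖ → IsRightCoherent (ZExt.grading ℬ)) ∧
      (¬ FiniteDimensional k B → ¬ IsNoetherianRing (ZExt ℬ)ᵐᵒᵖ) :=
  ⟨fun _ => ZExt.isRightCoherent hB,
    fun h _ => h (ZExt.finiteDimensional_of_isNoetherianRing hB)⟩
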